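/- Let $\mathbb K$ be a field, let $\Lambda$ be a finite dimensional $\mathbb K$-algebra, let $e\in\Lambda$ be an idempotent, $\Gamma=e\Lambda e$, and let $m\ge 1$ be an integer. For a finite dimensional algebra $A$ let $\operatorname{mod}A$ be the category of finitely generated left $A$-modules, and let the $m$-extended module category $$m\text{-}\operatorname{mod}A=\{X\in D^b(\operatorname{mod}A)\mid H^i(X)=0\text{ for }i\notin[-(m-1),0]\}$$ be viewed as a full subcategory of the derived category of $\operatorname{mod}A$. Let $\operatorname{res}_e\colon\operatorname{mod}\Lambda\to\operatorname{mod}\Gamma$, $M\mapsto eM$, be the restriction functor; it is exact, and applying it termwise to complexes gives a functor $\operatorname{res}_e\colon m\text{-}\operatorname{mod}\Lambda\to m\text{-}\operatorname{mod}\Gamma$. Let $L_e=\Lambda e\otimes_\Gamma-\colon\operatorname{mod}\Gamma\to\operatorname{mod}\Lambda$. Then $L_e$ is left adjoint to $\operatorname{res}_e$ on module categories. The total left derived functor $\mathbf LL_e\colon D^-(\operatorname{mod}\Gamma)\to D^-(\operatorname{mod}\Lambda)$ exists, and it is computed by projective resolutions: the canonical morphism $\mathbf LL_e(P)\to L_e(P)$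 is an isomorphism for every bounded above complex $P$ of projectives in $\operatorname{mod}\Gamma$. Let $\sigma^{\ge -(m-1)}$ be the truncation functor of the canonical $t$-structure on the derived category of $\operatorname{mod}\Lambda$. For every $Y\in m\text{-}\operatorname{mod}\Gamma$ the object $\sigma^{\ge-(m-1)}\mathbf LL_e(Y)$ lies in $m\text{-}\operatorname{mod}\Lambda$, and the resulting functor $$\widetilde{\mathbf L}L_e=\sigma^{\ge-(m-1)}\circ\mathbf LL_e\colon m\text{-}\operatorname{mod}\Gamma\to m\text{-}\operatorname{mod}\Lambda$$ is left adjoint to $\operatorname{res}_e\colon m\text{-}\operatorname{mod}\Lambda\to m\text{-}\operatorname{mod}\Gamma$. Moreover, $\widetilde{\mathbf L}L_e$ is fully faithful. -/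

import Mathlib

open CategoryTheory CategoryTheory.Limits
open scoped TensorProduct

universe w w' v u u'

/-! ### Corner rings, restriction `M ↦ eM` and induction `N ↦ Λe ⊗_Γ N` -/

namespace IsIdempotentElem

variable {Λ : Type u} [Ring Λ] {e : Λ} (he : IsIdempotentElem e)

/-- The underlying element of `Λ` of an element of the corner ring `Γ = eΛe`. -/
def Corner.val {he : IsIdempotentElem e} (g : he.Corner) : Λ := Subtype.val g

theorem Corner.mul_val {he : IsIdempotentElem e} (g : he.Corner) : e * g.val = g.val :=
  ((Subsemigroup.mem_corner_iff he).mp (Subtype.property g)).1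

theorem Corner.val_mul {he : IsIdempotentElem e} (g : he.Corner) : g.val * e = g.val :=
  ((Subsemigroup.mem_corner_iff he).mp (Subtype.property g)).2

/-- The element `e r e` of the corner ring `eΛe`. -/
def Corner.mk (r : Λ) : he.Corner := ⟨e * r * e, r, rfl⟩

section Restriction

/-- The subgroup `eM = {x ∈ M | e x = x}` of a left `Λ`-module `M`. -/
def part (_ : IsIdempotentElem e) (M : Type v) [AddCommGroup M] [Module Λ M] : AddSubgroup M where
  carrier := {x | e • x = x}
  zero_mem' := smul_zero e
  add_mem' {a b} ha hb := by
    simp only [Set.mem_ofPred_eq] at ha hb ⊢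
    rw [smul_add, ha, hb]
  neg_mem' {a} ha := by
    simp only [Set.mem_ofPred_eq] at ha ⊢
    rw [smul_neg, ha]

variable (M : Type v) [AddCommGroup M] [Module Λ M]

theorem mem_part {x : M} : x ∈ he.part M ↔ e • x = x := Iff.rfl

theorem smul_mem_part (x : M) : e • x ∈ he.part M := by
  rw [mem_part, smul_smul, he.eq]

/-- `eM` is a left module over `Γ = eΛe`, with the action of `Γ ⊆ Λ` on `M`. -/
instance : Module he.Corner (he.part M) where
  smul g x := ⟨g.val • (x : M), by rw [mem_part, smul_smul, g.mul_val]⟩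
  one_smul x := Subtype.ext x.2
  mul_smul g h x := Subtype.ext (mul_smul g.val h.val (x : M))
  smul_zero g := Subtype.ext (smul_zero g.val)
  smul_add g x y := Subtype.ext (smul_add g.val (x : M) y)
  add_smul g h x := Subtype.ext (add_smul g.val h.val (x : M))
  zero_smul x := Subtype.ext (zero_smul Λ (x : M))

theorem coe_smul_part (g : he.Corner) (x : he.part M) : ((g • x : he.part M) : M) = g.val • (x : M) :=
  rfl

variable {M} in
/-- A submodule of `eM` is recovered from the `Λ`-submodule of `M` which it generates. -/
theorem mem_of_coe_mem_span (N : Submodule he.Corner (he.part M)) (x : he.part M)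
    (hx : (x : M) ∈ Submodule.span Λ (Subtype.val '' (N : Set (he.part M)))) : x ∈ N := by
  have key : ∀ y ∈ Submodule.span Λ (Subtype.val '' (N : Set (he.part M))), ∀ r : Λ,
      (⟨e • r • y, he.smul_mem_part M _⟩ : he.part M) ∈ N := by
    intro y hy
    induction hy using Submodule.span_induction with
    | mem y hy =>
      obtain ⟨y, hy, rfl⟩ := hy
      intro r
      have : (⟨e • r • (y : M), he.smul_mem_part M _⟩ : he.part M) = Corner.mk he r • y := by
        apply Subtype.ext
        change e • r • (y : M) = (e * r * e) • (y : M)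
        rw [mul_smul, mul_smul, (he.mem_part M).1 y.2]
      rw [this]
      exact N.smul_mem _ hy
    | zero =>
      intro r
      convert N.zero_mem using 1
      apply Subtype.ext
      simp
    | add a b _ _ ha hb =>
      intro r
      convert N.add_mem (ha r) (hb r) using 1
      apply Subtype.ext
      simp
    | smul s a _ ha =>
      intro r
      convert ha (r * s) using 1
      apply Subtype.ext
      simp [mul_smul]
  convert key x hx 1 using 1
  apply Subtype.ext
  simpa using ((he.mem_part M).1 x.2).symm

instance isNoetherian_part [IsNoetherian Λ M] : IsNoetherian he.Corner (he.part M) := by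
  rw [isNoetherian_iff']
  let f : Submodule he.Corner (he.part M) → Submodule Λ M :=
    fun N => Submodule.span Λ (Subtype.val '' (N : Set (he.part M)))
  have hf : StrictMono f := by
    refine Monotone.strictMono_of_injective
      (fun N N' h => Submodule.span_mono (Set.image_mono h)) ?_
    intro N N' h
    ext x
    constructor
    · intro hx
      refine he.mem_of_coe_mem_span N' x ?_
      change (x : M) ∈ f N'
      rw [← h]
      exact Submodule.subset_span ⟨x, hx, rfl⟩
    · intro hx
      refine he.mem_of_coe_mem_span N x ?_
      change (x : M) ∈ f N
      rw [h]
      exact Submodule.subset_span ⟨x, hx, rfl⟩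
  exact hf.wellFoundedGT

/-- If `Λ` is left Noetherian, so is `Γ = eΛe`. -/
instance [IsNoetherianRing Λ] : IsNoetherianRing he.Corner := by
  let f : he.Corner →ₗ[he.Corner] he.part Λ :=
    { toFun := fun g => ⟨g.val, g.mul_val⟩
      map_add' := fun _ _ => rfl
      map_smul' := fun _ _ => rfl }
  exact isNoetherian_of_injective f fun g h hgh =>
    Subtype.ext (congrArg (fun x : he.part Λ => (x : Λ)) hgh)

variable {M} {M' : Type v} [AddCommGroup M'] [Module Λ M']

/-- The map `eM → eM'` induced by a `Λ`-linear map `M → M'`. -/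
def partMap (f : M →ₗ[Λ] M') : he.part M →ₗ[he.Corner] he.part M' where
  toFun x := ⟨f x, by rw [mem_part, ← map_smul, (he.mem_part M).1 x.2]⟩
  map_add' x y := Subtype.ext (map_add f (x : M) y)
  map_smul' g x := Subtype.ext (map_smul f g.val (x : M))

/-- The restriction functor `res_e : mod Λ ⥤ mod Γ`, `M ↦ eM`, where `Γ = eΛe`, on finitely
generated left modules. -/
def res [IsNoetherianRing Λ] : FGModuleCat.{v} Λ ⥤ FGModuleCat.{v} he.Corner where
  obj M := FGModuleCat.of he.Corner (he.part M)
  map f := FGModuleCat.ofHom (he.partMap f.hom.hom)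

instance [IsNoetherianRing Λ] : (res.{v} he).Additive where
  map_add := rfl

end Restriction

section Induction

/-- The left ideal `Λe = {x ∈ Λ | x e = x}`. -/
def leftIdeal (_ : IsIdempotentElem e) : Submodule Λ Λ where
  carrier := {x | x * e = x}
  zero_mem' := zero_mul e
  add_mem' {a b} ha hb := by
    simp only [Set.mem_ofPred_eq] at ha hb ⊢
    rw [add_mul, ha, hb]
  smul_mem' r a ha := by
    simp only [Set.mem_ofPred_eq, smul_eq_mul] at ha ⊢
    rw [mul_assoc, ha]

/-- The right action of `Γ = eΛe` on `Λe`. -/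
def rightMul (x : he.leftIdeal) (g : he.Corner) : he.leftIdeal :=
  ⟨(x : Λ) * g.val, by
    change (x : Λ) * g.val * e = _
    rw [mul_assoc, g.val_mul]⟩

variable (N : Type v) [AddCommGroup N] [Module he.Corner N]

/-- The relations `xg ⊗ y = x ⊗ gy` (for `x ∈ Λe`, `g ∈ Γ`, `y ∈ N`) defining `Λe ⊗_Γ N` as a
quotient of `Λe ⊗_ℤ N`. This set is stable under the left action of `Λ`, so the `Λ`-submodule which
it generates is the subgroup which it generates. -/
def balancedRel : Submodule Λ (he.leftIdeal ⊗[ℤ] N) :=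
  Submodule.span Λ
    {t | ∃ (x : he.leftIdeal) (g : he.Corner) (y : N),
      t = he.rightMul x g ⊗ₜ[ℤ] y - x ⊗ₜ[ℤ] (g • y)}

/-- The left `Λ`-module `Λe ⊗_Γ N`, where `Γ = eΛe`. -/
abbrev Ind : Type _ := (he.leftIdeal ⊗[ℤ] N) ⧸ he.balancedRel N

variable {N} in
/-- The pure tensor `x ⊗ y` in `Λe ⊗_Γ N`. -/
def indMk (x : he.leftIdeal) (y : N) : he.Ind N := (he.balancedRel N).mkQ (x ⊗ₜ[ℤ] y)

variable {N} in
theorem indMk_rightMul (x : he.leftIdeal) (g : he.Corner) (y : N) :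
    he.indMk (he.rightMul x g) y = he.indMk x (g • y) := by
  refine (Submodule.Quotient.eq _).2 (Submodule.subset_span ⟨x, g, y, rfl⟩)

/-- `e` as an element of `Λe`. -/
def idemElt : he.leftIdeal := ⟨e, he.eq⟩

variable {N} in
theorem indMk_eq_smul (x : he.leftIdeal) (y : N) :
    he.indMk x y = (x : Λ) • he.indMk he.idemElt y := by
  rw [indMk, indMk, ← map_smul, TensorProduct.smul_tmul']
  congr 2
  exact Subtype.ext x.2.symm

instance [Module.Finite he.Corner N] : Module.Finite Λ (he.Ind N) := by
  obtain ⟨S, hS⟩ := Module.Finite.fg_top (R := he.Corner) (M := N)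
  classical
  refine ⟨⟨S.image (he.indMk he.idemElt), ?_⟩⟩
  rw [eq_top_iff]
  have key : ∀ y : N, he.indMk he.idemElt y ∈
      Submodule.span Λ ((S.image (he.indMk he.idemElt) : Finset _) : Set (he.Ind N)) := by
    intro y
    have hy : y ∈ Submodule.span he.Corner (S : Set N) := by rw [hS]; trivial
    induction hy using Submodule.span_induction with
    | mem y hy =>
      refine Submodule.subset_span ?_
      simp only [Finset.coe_image]
      exact ⟨y, hy, rfl⟩
    | zero =>
      have : he.indMk he.idemElt (0 : N) = 0 := by simp [indMk]
      rw [this]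
      exact Submodule.zero_mem _
    | add a b _ _ ha hb =>
      have : he.indMk he.idemElt (a + b) = he.indMk he.idemElt a + he.indMk he.idemElt b := by
        simp [indMk, TensorProduct.tmul_add]
      rw [this]
      exact Submodule.add_mem _ ha hb
    | smul g a _ ha =>
      rw [← indMk_rightMul, indMk_eq_smul]
      exact Submodule.smul_mem _ _ ha
  rintro z -
  obtain ⟨z, rfl⟩ := (he.balancedRel N).mkQ_surjective z
  induction z using TensorProduct.induction_on with
  | zero => rw [map_zero]; exact Submodule.zero_mem _
  | tmul x y =>
    change he.indMk x y ∈ _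
    rw [indMk_eq_smul]
    exact Submodule.smul_mem _ _ (key y)
  | add a b ha hb => rw [map_add]; exact Submodule.add_mem _ ha hb

variable {N} {N' : Type v} [AddCommGroup N'] [Module he.Corner N']

/-- The map `Λe ⊗_Γ N → Λe ⊗_Γ N'` induced by a `Γ`-linear map `N → N'`. -/
def indMap (f : N →ₗ[he.Corner] N') : he.Ind N →ₗ[Λ] he.Ind N' :=
  (he.balancedRel N).mapQ (he.balancedRel N')
    (TensorProduct.AlgebraTensorModule.map LinearMap.id f.toAddMonoidHom.toIntLinearMap) (by
      rw [balancedRel, Submodule.span_le]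
      rintro _ ⟨x, g, y, rfl⟩
      refine Submodule.subset_span ⟨x, g, f y, ?_⟩
      simp)

@[simp]
theorem indMap_indMk (f : N →ₗ[he.Corner] N') (x : he.leftIdeal) (y : N) :
    he.indMap f (he.indMk x y) = he.indMk x (f y) := rfl

theorem ind_hom_ext {P : Type*} [AddCommGroup P] [Module Λ P] {f g : he.Ind N →ₗ[Λ] P}
    (h : ∀ x y, f (he.indMk x y) = g (he.indMk x y)) : f = g := by
  refine LinearMap.ext fun z => ?_
  obtain ⟨z, rfl⟩ := (he.balancedRel N).mkQ_surjective z
  induction z using TensorProduct.induction_on with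
  | zero => simp
  | tmul x y => exact h x y
  | add a b ha hb => rw [map_add, map_add, map_add, ha, hb]

/-- The functor `L_e = Λe ⊗_Γ - : mod Γ ⥤ mod Λ`, where `Γ = eΛe`, on finitely generated left
modules. -/
def ind : FGModuleCat.{u} he.Corner ⥤ FGModuleCat.{u} Λ where
  obj N := FGModuleCat.of Λ (he.Ind N)
  map f := FGModuleCat.ofHom (he.indMap f.hom.hom)
  map_id N := by
    apply FGModuleCat.hom_ext
    exact he.ind_hom_ext fun x y => rfl
  map_comp f g := by
    apply FGModuleCat.hom_ext
    exact he.ind_hom_ext fun x y => rfl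

instance : (ind he).Additive where
  map_add {N N' f g} := by
    apply FGModuleCat.hom_ext
    refine he.ind_hom_ext fun x y => ?_
    change he.indMk x (f.hom.hom y + g.hom.hom y) =
      he.indMk x (f.hom.hom y) + he.indMk x (g.hom.hom y)
    simp [indMk, TensorProduct.tmul_add]

end Induction

section Exactness

variable [IsNoetherianRing Λ]

/-- Exactness in `mod Λ` is exactness of the underlying maps. -/
theorem _root_.FGModuleCat.exact_iff_function_exact {R : Type u} [Ring R] [IsNoetherianRing R]
    (S : ShortComplex (FGModuleCat.{u} R)) :
    S.Exact ↔ Function.Exact S.f.hom.hom S.g.hom.hom := by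
  rw [← ShortComplex.exact_map_iff_of_faithful S (forget₂ (FGModuleCat.{u} R) (ModuleCat.{u} R)),
    ShortComplex.ShortExact.moduleCat_exact_iff_function_exact]
  rfl

theorem res_map_exact (S : ShortComplex (FGModuleCat.{u} Λ)) (hS : S.Exact) :
    (S.map (res.{u} he)).Exact := by
  rw [FGModuleCat.exact_iff_function_exact] at hS ⊢
  rintro ⟨y, hy⟩
  constructor
  · intro h
    obtain ⟨x, hx⟩ := (hS y).1 (congrArg Subtype.val h)
    refine ⟨⟨e • x, he.smul_mem_part _ x⟩, Subtype.ext ?_⟩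
    change S.f.hom.hom (e • x) = y
    rw [map_smul, hx]
    exact hy
  · rintro ⟨x, hx⟩
    apply Subtype.ext
    exact (hS y).2 ⟨Subtype.val x, congrArg Subtype.val hx⟩

instance : PreservesFiniteLimits (res.{u} he) :=
  have : PreservesFiniteLimits (res.{u} he) ∧ PreservesFiniteColimits (res.{u} he) :=
    ((Functor.exact_tfae (res.{u} he)).out 1 3).mp he.res_map_exact
  this.1

instance : PreservesFiniteColimits (res.{u} he) :=
  have : PreservesFiniteLimits (res.{u} he) ∧ PreservesFiniteColimits (res.{u} he) :=
    ((Functor.exact_tfae (res.{u} he)).out 1 3).mp he.res_map_exact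
  this.2

end Exactness

end IsIdempotentElem

/-! ### Extended module categories -/

namespace ExtendedModule

variable (C : Type u) [Category.{v} C] [Abelian C] [HasDerivedCategory.{w} C]

/-- The objects `X` of the derived category with `Hⁱ(X) = 0` for `i ∉ [-(m-1), 0]`; they are
automatically bounded (see `extProp_le_bounded`). -/
def extProp (m : ℕ) : ObjectProperty (DerivedCategory C) :=
  fun X => ∀ i : ℤ, i ∉ Set.Icc (-((m : ℤ) - 1)) 0 →
    IsZero ((DerivedCategory.homologyFunctor C i).obj X)

/-- The `m`-extended category of `C`; for `C = mod Λ` this is `m-mod Λ`. -/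
abbrev Ext (m : ℕ) : Type _ := (extProp C m).FullSubcategory

variable {C}

theorem extProp_iff (m : ℕ) (X : DerivedCategory C) :
    extProp C m X ↔ X.IsLE 0 ∧ X.IsGE (-((m : ℤ) - 1)) := by
  rw [DerivedCategory.isLE_iff, DerivedCategory.isGE_iff]
  constructor
  · intro h
    refine ⟨fun i hi => h i fun hi' => ?_, fun i hi => h i fun hi' => ?_⟩
    · exact absurd hi'.2 (by lia)
    · exact absurd hi'.1 (by lia)
  · rintro ⟨h₁, h₂⟩ i hi
    by_cases h : 0 < i
    · exact h₁ i h
    · refine h₂ i ?_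
      by_contra h'
      exact hi ⟨by lia, by lia⟩

theorem extProp_le_bounded (m : ℕ) :
    extProp C m ≤ (DerivedCategory.TStructure.t : Triangulated.TStructure (DerivedCategory C)).bounded :=
  fun X hX => ⟨⟨_, ((extProp_iff m X).1 hX).2⟩, ⟨_, ((extProp_iff m X).1 hX).1⟩⟩

theorem extProp_le_minus (m : ℕ) :
    extProp C m ≤ (DerivedCategory.TStructure.t : Triangulated.TStructure (DerivedCategory C)).minus :=
  fun X hX => ⟨_, ((extProp_iff m X).1 hX).1⟩

/-- The inclusion of `m-mod` into the bounded above derived category. -/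
noncomputable abbrev toMinus (m : ℕ) : Ext C m ⥤ DerivedCategory.Minus C :=
  ObjectProperty.ιOfLE (extProp_le_minus m)

/-! ### The functor on extended module categories induced by an exact functor -/

section Exact

variable {D : Type u'} [Category.{v} D] [Abelian D] [HasDerivedCategory.{w'} D]
  (F : C ⥤ D) [F.Additive] [PreservesFiniteLimits F] [PreservesFiniteColimits F]

theorem extProp_mapDerivedCategory (m : ℕ) (X : DerivedCategory C) (hX : extProp C m X) :
    extProp D m (F.mapDerivedCategory.obj X) := by
  rw [extProp_iff] at hX ⊢
  obtain ⟨h₁, h₂⟩ := hX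
  refine ⟨?_, ?_⟩
  · obtain ⟨K, e, hK⟩ := h₁
    exact ⟨(F.mapHomologicalComplex _).obj K, F.mapDerivedCategory.mapIso e ≪≫
      F.mapDerivedCategoryFactors.app K, inferInstance⟩
  · obtain ⟨K, e, hK⟩ := h₂
    exact ⟨(F.mapHomologicalComplex _).obj K, F.mapDerivedCategory.mapIso e ≪≫
      F.mapDerivedCategoryFactors.app K, inferInstance⟩

/-- The functor `m-C ⥤ m-D` which an exact functor `F : C ⥤ D` induces by applying `F` to complexes
termwise. -/
noncomputable def mapExt (m : ℕ) : Ext C m ⥤ Ext D m :=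
  (extProp D m).lift ((extProp C m).ι ⋙ F.mapDerivedCategory)
    fun X => extProp_mapDerivedCategory F m X.obj X.property

end Exact

/-! ### Left derived functors on bounded above derived categories -/

section LeftDerived

variable (C) in
/-- The property of being a bounded above complex: `Kⁱ = 0` for `i ≫ 0`. -/
def minusComplex : ObjectProperty (CochainComplex C ℤ) :=
  fun K => ∃ n : ℤ, K.IsStrictlyLE n

variable (C) in
/-- The category of bounded above cochain complexes. -/
abbrev MinusComplex : Type _ := (minusComplex C).FullSubcategory

variable (C) in
/-- The localization functor from bounded above complexes to the bounded above derived category. -/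
noncomputable def minusQ : MinusComplex C ⥤ DerivedCategory.Minus C :=
  ObjectProperty.lift _ ((minusComplex C).ι ⋙ DerivedCategory.Q) (by
    rintro ⟨K, n, hK⟩
    exact ⟨n, K, Iso.refl _, hK⟩)

variable {D : Type u'} [Category.{v} D] [Abelian D] [HasDerivedCategory.{w'} D]
  (F : C ⥤ D) [F.Additive]

/-- Termwise application of an additive functor to bounded above complexes. -/
def mapMinusComplex : MinusComplex C ⥤ MinusComplex D :=
  ObjectProperty.lift _ ((minusComplex C).ι ⋙ F.mapHomologicalComplex (ComplexShape.up ℤ)) (by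
    rintro ⟨K, n, hK⟩
    exact ⟨n, (inferInstance :
      CochainComplex.IsStrictlyLE ((F.mapHomologicalComplex (ComplexShape.up ℤ)).obj K) n)⟩)

/-- `F` has a (total) left derived functor `D⁻(C) ⥤ D⁻(D)`, i.e. a right Kan extension of
`K ↦ F(K)` along the localization functor. -/
abbrev HasLeftDerivedMinus : Prop :=
  (minusQ C).HasRightKanExtension (mapMinusComplex F ⋙ minusQ D)

/-- `LF : D⁻(C) ⥤ D⁻(D)`, with the comparison maps `LF(K) ⟶ F(K)` given by `α`, is the (total) left
derived functor of `F`. -/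
abbrev IsLeftDerivedMinus (LF : DerivedCategory.Minus C ⥤ DerivedCategory.Minus D)
    (α : minusQ C ⋙ LF ⟶ mapMinusComplex F ⋙ minusQ D) : Prop :=
  LF.IsRightKanExtension α

variable {F} in
/-- The composition `σ^{≥ -(m-1)} ∘ LF` on the `m`-extended category of `C`, as a functor to the
derived category of `D`. -/
noncomputable def truncDerived (LF : DerivedCategory.Minus C ⥤ DerivedCategory.Minus D) (m : ℕ) :
    Ext C m ⥤ DerivedCategory D :=
  toMinus m ⋙ LF ⋙ DerivedCategory.Minus.ι ⋙
    DerivedCategory.TStructure.t.truncGE (-((m : ℤ) - 1))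

end LeftDerived

end ExtendedModule

/-! Write `F ⊣ R` for the adjunction `L_e ⊣ res_e`. Two facts drive the proof: `R` is exact, and the
unit `N ⟶ e(Λe ⊗_Γ N)` is an isomorphism (`indUnit_injective`, `indUnit_surjective`).

Bounded above complexes of projectives compute `D⁻`, so `LF` exists and is `F` termwise on them
(`Functor.exists_isRightKanExtension_of_resolutions`). Since `R` is exact, `F` preserves
projectives; for a projective complex `P`, maps out of `P` and out of `F(P)` in the derived category
are thus homotopy classes of chain maps, and the termwise adjunction gives `Hom(LF Y, X) ≃ Hom(Y, R
X)` (`Q_map_unitComplex_bijective`). On `P` the derived unit is the termwise unit, hence an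
isomorphism.

For `X` in degrees `≥ -(m-1)`, maps `LF Y ⟶ X` factor uniquely through `σ^{≥ -(m-1)} LF Y`, which
yields the truncated adjunction. Its unit is `Y ≅ R(LF Y) ⟶ R(σ^{≥ -(m-1)} LF Y)`. As `R(LF Y) ≅ Y`
lies in degrees `≥ -(m-1)`, the exact functor `R` kills the part of `LF Y` which is truncated away
(`isIso_mapDerivedCategory_map_truncGEπ`). So the unit is an isomorphism, and the left adjoint is
fully faithful. -/

namespace CochainComplex

/-! ### Projective resolutions of bounded above complexes. -/

variable {C : Type u} [Category.{v} C] [Abelian C]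

/-- Degree `-m` of `f` corresponds to degree `m` of its opposite, and being a quasi-isomorphism of
short complexes is self-dual. -/
theorem quasiIso_of_opEquivalence_map {K L : CochainComplex C ℤ} (f : K ⟶ L)
    (hf : QuasiIso ((opEquivalence C).functor.map f.op)) : QuasiIso f := by
  suffices ∀ m : ℤ, QuasiIsoAt f (-m) from ⟨fun n => neg_neg n ▸ this (-n)⟩
  intro m
  have h := hf.quasiIsoAt m
  rw [quasiIsoAt_iff' _ (m - 1) m (m + 1) (by simp) (by simp)] at h
  rw [quasiIsoAt_iff' _ (-(m + 1)) (-m) (-(m - 1)) (by grind [prev]) (by grind [next]),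
    ← ShortComplex.quasiIso_opMap_iff]
  exact h

/-- Dual to injective resolutions of bounded below complexes, applied in `Cᵒᵖ`. Keeping the same
bound `n` is what later shows that left derived functors preserve cohomological upper bounds. -/
theorem exists_projective_quasiIso [EnoughProjectives C] (K : CochainComplex C ℤ) (n : ℤ)
    [K.IsStrictlyLE n] :
    ∃ (P : CochainComplex C ℤ) (p : P ⟶ K), QuasiIso p ∧ (∀ i, Projective (P.X i)) ∧
      P.IsStrictlyLE n := by
  have : ((opEquivalence C).functor.obj (.op K)).IsStrictlyGE (-n) := by
    rw [isStrictlyGE_iff]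
    intro i hi
    exact (K.isZero_of_isStrictlyLE n (-i) (by lia)).op
  obtain ⟨L, j, hj, hL, hLn⟩ := CochainComplex.Plus.modelCategoryQuillen.exists_quasiIso_injective
    ((opEquivalence C).functor.obj (.op K)) (-n)
  obtain ⟨P, ⟨e⟩⟩ : ∃ P : CochainComplex C ℤ,
      Nonempty (L ≅ (opEquivalence C).functor.obj (.op P)) :=
    ⟨((opEquivalence C).inverse.obj L).unop, ⟨((opEquivalence C).counitIso.app L).symm⟩⟩
  obtain ⟨q, hq⟩ := (opEquivalence C).functor.map_surjective (j ≫ e.hom)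
  have eX (i : ℤ) : L.X (-i) ≅ .op (P.X i) :=
    (HomologicalComplex.eval _ _ (-i)).mapIso e ≪≫ (P.XIsoOfEq (neg_neg i).symm).op
  refine ⟨P, q.unop, quasiIso_of_opEquivalence_map _ ?_, fun i => ?_, ?_⟩
  · rw [Quiver.Hom.op_unop, hq]
    infer_instance
  · have : Injective (Opposite.op (P.X i)) := Injective.of_iso (eX i) (hL _)
    exact Injective.projective_iff_injective_op.2 this
  · rw [isStrictlyLE_iff]
    intro i hi
    exact ((L.isZero_of_isStrictlyGE (-n) (-i) (by lia)).of_iso (eX i).symm).unop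

end CochainComplex

/-! ### Natural transformations, adjunctions and Kan extensions from resolutions. -/

namespace CategoryTheory

section

variable {A B H : Type*} [Category* A] [Category* B] [Category* H]

/-- Natural transformations extend along a full and essentially surjective functor. -/
noncomputable def Functor.extendNatTrans (I : A ⥤ B) [I.Full] [I.EssSurj] {G₁ G₂ : B ⥤ H}
    (τ : I ⋙ G₁ ⟶ I ⋙ G₂) : G₁ ⟶ G₂ where
  app Y := G₁.map (I.objObjPreimageIso Y).inv ≫ τ.app (I.objPreimage Y) ≫
    G₂.map (I.objObjPreimageIso Y).hom
  naturality Y Y' f := by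
    obtain ⟨g, hg⟩ := I.map_surjective
      ((I.objObjPreimageIso Y).hom ≫ f ≫ (I.objObjPreimageIso Y').inv)
    have h := τ.naturality g
    dsimp only [Functor.comp_map] at h
    have h₁ : f ≫ (I.objObjPreimageIso Y').inv = (I.objObjPreimageIso Y).inv ≫ I.map g := by
      simp [hg]
    have h₂ : I.map g ≫ (I.objObjPreimageIso Y').hom = (I.objObjPreimageIso Y).hom ≫ f := by
      simp [hg]
    rw [← G₁.map_comp_assoc, h₁, G₁.map_comp_assoc, reassoc_of% h, ← G₂.map_comp, h₂]
    simp

/-- The chosen preimage of `I.obj X` need not be `X`; fullness lifts the comparison isomorphism to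
`A`, where naturality of `τ` applies. -/
theorem Functor.extendNatTrans_app (I : A ⥤ B) [I.Full] [I.EssSurj] {G₁ G₂ : B ⥤ H}
    (τ : I ⋙ G₁ ⟶ I ⋙ G₂) (X : A) : (I.extendNatTrans τ).app (I.obj X) = τ.app X := by
  obtain ⟨g, hg⟩ := I.map_surjective (I.objObjPreimageIso (I.obj X)).hom
  have h := τ.naturality g
  dsimp only [Functor.comp_map] at h
  dsimp only [extendNatTrans]
  rw [← hg, ← h, ← G₁.map_comp_assoc, hg]
  simp

/-- A natural transformation `𝟭 ⟶ L ⋙ R` with the universal property of a unit is the unit of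
an adjunction. -/
noncomputable def Adjunction.ofUnitBijective {L : A ⥤ B} {R : B ⥤ A} (η : 𝟭 A ⟶ L ⋙ R)
    (h : ∀ X Y, Function.Bijective (fun f : L.obj X ⟶ Y => η.app X ≫ R.map f)) : L ⊣ R :=
  Adjunction.mkOfHomEquiv
    { homEquiv := fun X Y => Equiv.ofBijective _ (h X Y)
      homEquiv_naturality_left_symm := fun {X' X Y} f g => by
        rw [Equiv.symm_apply_eq]
        obtain ⟨g, rfl⟩ := (h X Y).surjective g
        have := η.naturality f
        dsimp at this
        simp [Equiv.ofBijective_symm_apply_apply, reassoc_of% this]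
      homEquiv_naturality_right := by simp }

theorem Adjunction.ofUnitBijective_unit {L : A ⥤ B} {R : B ⥤ A} (η : 𝟭 A ⟶ L ⋙ R)
    (h : ∀ X Y, Function.Bijective (fun f : L.obj X ⟶ Y => η.app X ≫ R.map f)) :
    (Adjunction.ofUnitBijective η h).unit = η := by
  ext X
  simp [ofUnitBijective]

theorem Functor.isRightKanExtension_of_existsUnique {L : A ⥤ B} {F : A ⥤ H} {G : B ⥤ H}
    (α : L ⋙ G ⟶ F)
    (h : ∀ (M : B ⥤ H) (β : L ⋙ M ⟶ F), ∃! γ : M ⟶ G, Functor.whiskerLeft L γ ≫ α = β) :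
    G.IsRightKanExtension α := by
  choose γ hγ hγ' using h
  exact ⟨⟨IsTerminal.ofUniqueHom
    (fun M => CostructuredArrow.homMk (γ M.left M.hom) (hγ M.left M.hom))
    fun M φ => CostructuredArrow.hom_ext _ _ (hγ' M.left M.hom φ.left (CostructuredArrow.w φ))⟩⟩

variable {L : A ⥤ B} {F : A ⥤ H} {P : ObjectProperty A}

/-- If every object of `B` is of the form `L X` with `X` in `P`, and every morphism `L X ⟶ L Y` with
`X` in `P` lifts to a morphism `X ⟶ Y` whose image under `F` is unique, then `F` has a right Kan
extension along `L`, which is computed by objects in `P`. -/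
theorem Functor.exists_isRightKanExtension_of_resolutions
    (h₁ : ∀ Y : B, ∃ X, P X ∧ Nonempty (L.obj X ≅ Y))
    (h₂ : ∀ X Y, P X → Function.Surjective (L.map : (X ⟶ Y) → _))
    (h₃ : ∀ {X Y} (f g : X ⟶ Y), P X → L.map f = L.map g → F.map f = F.map g) :
    ∃ (G : B ⥤ H) (α : L ⋙ G ⟶ F), G.IsRightKanExtension α ∧ ∀ X, P X → IsIso (α.app X) := by
  choose r hr e using h₁
  replace e := fun Y => (e Y).some
  choose l hl using h₂
  -- The chosen lifts `l` need not respect composition, but by `h₃` their images under `F` do.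
  have hF {X Y Z} (hX : P X) (hY : P Y) (f : L.obj X ⟶ L.obj Y) (g : L.obj Y ⟶ L.obj Z) :
      F.map (l X Z hX (f ≫ g)) = F.map (l X Y hX f) ≫ F.map (l Y Z hY g) := by
    rw [← F.map_comp]
    exact h₃ _ _ hX (by simp [hl])
  let G : B ⥤ H :=
    { obj := fun Y => F.obj (r Y)
      map := fun {Y Y'} f => F.map (l _ _ (hr Y) ((e Y).hom ≫ f ≫ (e Y').inv))
      map_id := fun Y => by
        rw [← F.map_id]
        exact h₃ _ _ (hr Y) (by simp [hl])
      map_comp := fun f g => by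
        rw [← hF]
        simp }
  let α : L ⋙ G ⟶ F :=
    { app := fun X => F.map (l _ _ (hr (L.obj X)) (e (L.obj X)).hom)
      naturality := fun X Y f => by
        dsimp [G]
        rw [← hF, ← F.map_comp]
        exact h₃ _ _ (hr _) (by simp [hl]) }
  have hα (X : A) (hX : P X) : IsIso (α.app X) := by
    refine ⟨F.map (l _ _ hX (e (L.obj X)).inv), ?_, ?_⟩
    · dsimp [α]
      rw [← F.map_comp]
      exact (h₃ _ (𝟙 _) (hr _) (by simp [hl])).trans (F.map_id _)
    · dsimp [α]
      rw [← hF]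
      exact (h₃ _ (𝟙 _) hX (by simp [hl])).trans (F.map_id _)
  refine ⟨G, α, isRightKanExtension_of_existsUnique α fun M β => ?_, hα⟩
  -- Go to the resolution `r Y` of `Y`, then apply `β` there, since `G.obj Y` is `F.obj (r Y)`.
  refine ⟨{ app := fun Y => M.map (e Y).inv ≫ β.app (r Y), naturality := fun Y Y' f => ?_ }, ?_,
    fun γ hγ => ?_⟩
  · have h := β.naturality (l _ _ (hr Y) ((e Y).hom ≫ f ≫ (e Y').inv))
    dsimp at h
    dsimp [G]
    rw [Category.assoc, ← h, hl, ← M.map_comp_assoc, ← M.map_comp_assoc]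
    simp
  · ext X
    have h := β.naturality (l _ _ (hr (L.obj X)) (e (L.obj X)).hom)
    dsimp at h
    dsimp [α]
    rw [Category.assoc, ← h, hl, ← M.map_comp_assoc]
    simp
  · ext Y
    -- Uniqueness: `α` is invertible at `r Y`, so the factorization condition determines `γ` at
    -- `L.obj (r Y)`, and naturality along `e Y` determines it at `Y`.
    have h := congr_app hγ (r Y)
    have := hα _ (hr Y)
    dsimp only [NatTrans.comp_app, whiskerLeft_app] at h ⊢
    rw [← h, ← Category.assoc, γ.naturality, Category.assoc]
    dsimp [G, α]
    rw [← hF]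
    exact ((Category.comp_id _).symm.trans (congrArg _ ((F.map_id _).symm.trans
      (h₃ _ _ (hr _) (by simp [hl])))))

end

end CategoryTheory

namespace CategoryTheory

variable {A B B' : Type*} [Category* A] [Category* B] [Category* B']

theorem NatTrans.bijective_app_comp_map_of_iso {I : A ⥤ B} {L : A ⥤ B'} {R : B' ⥤ B}
    (η : I ⟶ L ⋙ R) {Y Y' : A} {X X' : B'} (e : Y ≅ Y') (e' : X ≅ X')
    (h : Function.Bijective (fun f : L.obj Y ⟶ X => η.app Y ≫ R.map f)) :
    Function.Bijective (fun f : L.obj Y' ⟶ X' => η.app Y' ≫ R.map f) := by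
  have hη : η.app Y' = I.map e.inv ≫ η.app Y ≫ R.map (L.map e.hom) := by
    have := η.naturality e.hom
    dsimp at this
    rw [← this, ← I.map_comp_assoc]
    simp
  rw [← Function.Bijective.of_comp_iff _ (((L.mapIso e).homCongr e').bijective),
    ← Function.Bijective.of_comp_iff' ((I.mapIso e).homCongr (R.mapIso e')).symm.bijective]
  convert h using 1
  ext f
  simp only [Function.comp_apply, Iso.homCongr_apply, Iso.homCongr_symm,
    Functor.mapIso_hom, Functor.mapIso_inv, Iso.symm_hom, Iso.symm_inv, hη, Functor.map_comp,
    Category.assoc, Iso.map_hom_inv_id_assoc, Iso.map_hom_inv_id, Category.comp_id]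
  simp only [← R.map_comp_assoc, ← L.map_comp, Iso.hom_inv_id, L.map_id, R.map_id,
    Category.id_comp]

end CategoryTheory

/-! ### Morphisms out of K-projective complexes in the derived category. -/

namespace CochainComplex.IsKProjective

variable {C : Type u} [Category.{v} C] [Abelian C] [HasDerivedCategory.{w} C]
  (K L : CochainComplex C ℤ) [K.IsKProjective]

theorem Q_map_surjective :
    Function.Surjective (DerivedCategory.Q.map : (K ⟶ L) → _) := by
  intro f
  obtain ⟨g, hg⟩ := (Qh_map_bijective K ((HomotopyCategory.quotient _ _).obj L)).surjective
    ((DerivedCategory.quotientCompQhIso C).hom.app K ≫ f ≫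
      (DerivedCategory.quotientCompQhIso C).inv.app L)
  obtain ⟨g, rfl⟩ := (HomotopyCategory.quotient _ _).map_surjective g
  refine ⟨g, ?_⟩
  have h := (DerivedCategory.quotientCompQhIso C).hom.naturality g
  rw [Functor.comp_map, hg] at h
  rw [← cancel_epi ((DerivedCategory.quotientCompQhIso C).hom.app K), ← h]
  simp

variable {K L} in
theorem nonempty_homotopy_of_Q_map_eq (f g : K ⟶ L)
    (h : DerivedCategory.Q.map f = DerivedCategory.Q.map g) : Nonempty (Homotopy f g) := by
  refine ⟨HomotopyCategory.homotopyOfEq _ _ ((Qh_map_bijective K _).injective ?_)⟩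
  have hf := (DerivedCategory.quotientCompQhIso C).hom.naturality f
  have hg := (DerivedCategory.quotientCompQhIso C).hom.naturality g
  rw [← h, ← hf] at hg
  exact ((cancel_mono _).1 hg).symm

end CochainComplex.IsKProjective

/-! ### Left derived functors on bounded above derived categories. -/

namespace ExtendedModule

variable (C : Type u) [Category.{v} C] [Abelian C]

/-- Bounded above complexes of projective objects. -/
def projectiveComplex : ObjectProperty (MinusComplex C) := fun P => ∀ i, Projective (P.obj.X i)

variable {C}

theorem projectiveComplex.isKProjective {P : MinusComplex C} (hP : projectiveComplex C P) :
    P.obj.IsKProjective := by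
  obtain ⟨n, hn⟩ := P.property
  have (i : ℤ) := hP i
  exact CochainComplex.isKProjective_of_projective P.obj n

section UnitCounit

variable {D : Type u'} [Category.{v} D] [Abelian D] {F : C ⥤ D} [F.Additive] {R : D ⥤ C}
  [R.Additive] (adj : F ⊣ R)

/-- The morphism `K ⟶ R(F(K))` given by the unit of `F ⊣ R` in each degree. -/
@[simps]
def unitComplex (K : CochainComplex C ℤ) :
    K ⟶ (R.mapHomologicalComplex _).obj ((F.mapHomologicalComplex (ComplexShape.up ℤ)).obj K) where
  f i := adj.unit.app (K.X i)
  comm' i j _ := (adj.unit.naturality (K.d i j)).symm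

/-- The morphism `F(R(K)) ⟶ K` given by the counit of `F ⊣ R` in each degree. -/
@[simps]
def counitComplex (K : CochainComplex D ℤ) :
    (F.mapHomologicalComplex _).obj ((R.mapHomologicalComplex (ComplexShape.up ℤ)).obj K) ⟶ K where
  f i := adj.counit.app (K.X i)
  comm' i j _ := (adj.counit.naturality (K.d i j)).symm

theorem unitComplex_naturality {K L : CochainComplex C ℤ} (f : K ⟶ L) :
    f ≫ unitComplex adj L = unitComplex adj K ≫
      (R.mapHomologicalComplex _).map ((F.mapHomologicalComplex (ComplexShape.up ℤ)).map f) := by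
  ext i
  exact adj.unit.naturality (f.f i)

theorem counitComplex_naturality {K L : CochainComplex D ℤ} (f : K ⟶ L) :
    (F.mapHomologicalComplex _).map ((R.mapHomologicalComplex (ComplexShape.up ℤ)).map f) ≫
      counitComplex adj L = counitComplex adj K ≫ f := by
  ext i
  exact adj.counit.naturality (f.f i)

theorem map_unitComplex_counitComplex (K : CochainComplex C ℤ) :
    (F.mapHomologicalComplex _).map (unitComplex adj K) ≫
      counitComplex adj ((F.mapHomologicalComplex (ComplexShape.up ℤ)).obj K) = 𝟙 _ := by
  ext i
  exact adj.left_triangle_components (K.X i)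

theorem unitComplex_map_counitComplex (K : CochainComplex D ℤ) :
    unitComplex adj ((R.mapHomologicalComplex (ComplexShape.up ℤ)).obj K) ≫
      (R.mapHomologicalComplex _).map (counitComplex adj K) = 𝟙 _ := by
  ext i
  exact adj.right_triangle_components (K.X i)

instance [IsIso adj.unit] (K : CochainComplex C ℤ) : IsIso (unitComplex adj K) :=
  have (i : ℤ) : IsIso ((unitComplex adj K).f i) :=
    inferInstanceAs (IsIso (adj.unit.app (K.X i)))
  HomologicalComplex.Hom.isIso_of_components _

omit [R.Additive] in
include adj in
-- A left adjoint preserves projectives when its right adjoint preserves epimorphisms. This makes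
-- `F(P)` K-projective.
theorem projectiveComplex.map [R.PreservesEpimorphisms] {P : MinusComplex C}
    (hP : projectiveComplex C P) : projectiveComplex D ((mapMinusComplex F).obj P) :=
  fun i => adj.map_projective _ (hP i)

end UnitCounit

variable [HasDerivedCategory.{w} C]

theorem minusQ_map_surjective {P : MinusComplex C} (hP : projectiveComplex C P)
    (K : MinusComplex C) : Function.Surjective ((minusQ C).map : (P ⟶ K) → _) := by
  have := hP.isKProjective
  intro f
  obtain ⟨g, hg⟩ := CochainComplex.IsKProjective.Q_map_surjective P.obj K.obj f.hom
  exact ⟨ObjectProperty.homMk g, ObjectProperty.hom_ext _ hg⟩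

theorem nonempty_homotopy_of_minusQ_map_eq {P K : MinusComplex C} (hP : projectiveComplex C P)
    (f g : P ⟶ K) (h : (minusQ C).map f = (minusQ C).map g) :
    Nonempty (Homotopy f.hom g.hom) := by
  have := hP.isKProjective
  exact CochainComplex.IsKProjective.nonempty_homotopy_of_Q_map_eq _ _
    (congrArg (fun φ => φ.hom) h)

/-- Every object of `D⁻(C)` which is cohomologically `≤ n` has a projective resolution in degrees
`≤ n`. -/
theorem exists_projectiveComplex_iso [EnoughProjectives C] (Y : DerivedCategory.Minus C) (n : ℤ)
    (hY : Y.obj.IsLE n) :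
    ∃ P, projectiveComplex C P ∧ P.obj.IsStrictlyLE n ∧ Nonempty ((minusQ C).obj P ≅ Y) := by
  obtain ⟨K, hK, ⟨e⟩⟩ := Y.obj.exists_iso_Q_obj_of_isLE n
  obtain ⟨P, p, hp, hP, hPn⟩ := CochainComplex.exists_projective_quasiIso K n
  exact ⟨⟨P, n, hPn⟩, hP, hPn,
    ⟨DerivedCategory.Minus.ι.preimageIso ((asIso (DerivedCategory.Q.map p) :) ≪≫ e.symm)⟩⟩

theorem exists_projectiveComplex_iso' [EnoughProjectives C] (Y : DerivedCategory.Minus C) :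
    ∃ P, projectiveComplex C P ∧ Nonempty ((minusQ C).obj P ≅ Y) := by
  obtain ⟨n, hn⟩ := Y.property
  obtain ⟨P, hP, -, h⟩ := exists_projectiveComplex_iso Y n hn
  exact ⟨P, hP, h⟩

variable {D : Type u'} [Category.{v} D] [Abelian D] [HasDerivedCategory.{w'} D]
  (F : C ⥤ D) [F.Additive]

/-- Lifts to chain maps out of projective complexes are unique up to homotopy, and an additive
functor preserves homotopies, so the resolution criterion applies. -/
theorem exists_isLeftDerivedMinus [EnoughProjectives C] :
    ∃ (LF : DerivedCategory.Minus C ⥤ DerivedCategory.Minus D)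
      (α : minusQ C ⋙ LF ⟶ mapMinusComplex F ⋙ minusQ D),
      IsLeftDerivedMinus F LF α ∧ ∀ P, projectiveComplex C P → IsIso (α.app P) := by
  refine Functor.exists_isRightKanExtension_of_resolutions exists_projectiveComplex_iso'
    (fun P K hP => minusQ_map_surjective hP K) fun f g hP h => ?_
  obtain ⟨H⟩ := nonempty_homotopy_of_minusQ_map_eq hP f g h
  exact ObjectProperty.hom_ext _ (DerivedCategory.Q_map_eq_of_homotopy _ (F.mapHomotopy H))

variable {F}

/-- Right Kan extensions are unique up to an isomorphism compatible with the comparison maps, so the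
property passes from the constructed derived functor to any other. -/
theorem isIso_app_of_isLeftDerivedMinus [EnoughProjectives C]
    {LF : DerivedCategory.Minus C ⥤ DerivedCategory.Minus D}
    {α : minusQ C ⋙ LF ⟶ mapMinusComplex F ⋙ minusQ D} (h : IsLeftDerivedMinus F LF α)
    {P : MinusComplex C} (hP : projectiveComplex C P) : IsIso (α.app P) := by
  obtain ⟨LF', α', h', hα'⟩ := exists_isLeftDerivedMinus F
  have := hα' P hP
  let e := Functor.rightKanExtensionUnique LF α LF' α'
  have he : e.hom.app ((minusQ C).obj P) ≫ α'.app P = α.app P := by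
    simp [e, Functor.rightKanExtensionUnique, Functor.rightKanExtensionUniqueOfIso]
  rw [← he]
  infer_instance

section

variable [EnoughProjectives C]

instance : ((projectiveComplex C).ι ⋙ minusQ C).Full where
  map_surjective {P K} f := by
    obtain ⟨g, hg⟩ := minusQ_map_surjective P.property K.obj f
    exact ⟨ObjectProperty.homMk g, hg⟩

instance : ((projectiveComplex C).ι ⋙ minusQ C).EssSurj where
  mem_essImage Y := by
    obtain ⟨P, hP, e⟩ := exists_projectiveComplex_iso' Y
    exact ⟨⟨P, hP⟩, e⟩

end

/-! ### Deriving an adjunction with an exact right adjoint -/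

section Adjunction

section

variable [EnoughProjectives C] {LF : DerivedCategory.Minus C ⥤ DerivedCategory.Minus D}
  {α : minusQ C ⋙ LF ⟶ mapMinusComplex F ⋙ minusQ D} (h : IsLeftDerivedMinus F LF α)

/-- The isomorphism `LF(P) ≅ F(P)` for a bounded above complex `P` of projectives. -/
noncomputable def derivedIso (P : MinusComplex C) (hP : projectiveComplex C P) :
    (LF.obj ((minusQ C).obj P)).obj ≅
      DerivedCategory.Q.obj ((F.mapHomologicalComplex (ComplexShape.up ℤ)).obj P.obj) :=
  have := isIso_app_of_isLeftDerivedMinus h hP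
  DerivedCategory.Minus.ι.mapIso (asIso (α.app P))

theorem derivedIso_hom_naturality {P P' : MinusComplex C} (hP : projectiveComplex C P)
    (hP' : projectiveComplex C P') (f : P ⟶ P') :
    (LF.map ((minusQ C).map f)).hom ≫ (derivedIso h P' hP').hom =
      (derivedIso h P hP).hom ≫
        DerivedCategory.Q.map ((F.mapHomologicalComplex (ComplexShape.up ℤ)).map f.hom) :=
  congrArg (fun φ => φ.hom) (α.naturality f)

theorem derivedIso_inv_naturality {P P' : MinusComplex C} (hP : projectiveComplex C P)
    (hP' : projectiveComplex C P') (f : P ⟶ P') :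
    DerivedCategory.Q.map ((F.mapHomologicalComplex (ComplexShape.up ℤ)).map f.hom) ≫
      (derivedIso h P' hP').inv =
        (derivedIso h P hP).inv ≫ (LF.map ((minusQ C).map f)).hom := by
  rw [Iso.comp_inv_eq, Category.assoc, derivedIso_hom_naturality h hP hP', Iso.inv_hom_id_assoc]

end

variable {R : D ⥤ C} [R.Additive] [PreservesFiniteLimits R] [PreservesFiniteColimits R]
  (adj : F ⊣ R)

theorem Q_map_unitComplex_comp (K : CochainComplex C ℤ) (L : CochainComplex D ℤ)
    (g : (F.mapHomologicalComplex (ComplexShape.up ℤ)).obj K ⟶ L) :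
    DerivedCategory.Q.map (unitComplex adj K) ≫ R.mapDerivedCategoryFactors.inv.app _ ≫
      R.mapDerivedCategory.map (DerivedCategory.Q.map g) =
    DerivedCategory.Q.map (unitComplex adj K ≫ (R.mapHomologicalComplex _).map g) ≫
      R.mapDerivedCategoryFactors.inv.app L := by
  have h₁ := R.mapDerivedCategoryFactors.inv.naturality g
  dsimp only [Functor.comp_map] at h₁
  rw [← h₁, Functor.map_comp, Category.assoc]

/-- Both `P` and `F(P)` are K-projective, so both sides are homotopy classes of chain maps, which
the termwise adjunction identifies because `F` and `R` preserve homotopies. -/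
theorem Q_map_unitComplex_bijective (P : MinusComplex C) (hP : projectiveComplex C P)
    (K : CochainComplex D ℤ) :
    Function.Bijective (fun f : DerivedCategory.Q.obj
        ((F.mapHomologicalComplex (ComplexShape.up ℤ)).obj P.obj) ⟶ DerivedCategory.Q.obj K =>
      DerivedCategory.Q.map (unitComplex adj P.obj) ≫
        R.mapDerivedCategoryFactors.inv.app _ ≫ R.mapDerivedCategory.map f) := by
  have : CochainComplex.IsKProjective
      ((F.mapHomologicalComplex (ComplexShape.up ℤ)).obj P.obj) := (hP.map adj).isKProjective
  have := hP.isKProjective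
  constructor
  · intro f g hfg
    obtain ⟨f, rfl⟩ := CochainComplex.IsKProjective.Q_map_surjective _ _ f
    obtain ⟨g, rfl⟩ := CochainComplex.IsKProjective.Q_map_surjective _ _ g
    dsimp only at hfg
    rw [Q_map_unitComplex_comp, Q_map_unitComplex_comp, cancel_mono] at hfg
    obtain ⟨H⟩ := CochainComplex.IsKProjective.nonempty_homotopy_of_Q_map_eq _ _ hfg
    -- Taking the adjunct twice returns `g`, so the homotopy `H` between the adjuncts yields one
    -- between `f` and `g`.
    have h' (g : (F.mapHomologicalComplex (ComplexShape.up ℤ)).obj P.obj ⟶ K) :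
        (F.mapHomologicalComplex _).map
          (unitComplex adj P.obj ≫ (R.mapHomologicalComplex _).map g) ≫ counitComplex adj K = g := by
      rw [Functor.map_comp, Category.assoc, counitComplex_naturality,
        reassoc_of% map_unitComplex_counitComplex adj]
    rw [← h' f, ← h' g, Functor.map_comp, Functor.map_comp _ _ (counitComplex adj K),
      DerivedCategory.Q_map_eq_of_homotopy _ (F.mapHomotopy H)]
  · intro k
    obtain ⟨g, hg⟩ := CochainComplex.IsKProjective.Q_map_surjective _ _
      (k ≫ R.mapDerivedCategoryFactors.hom.app K)
    refine ⟨DerivedCategory.Q.map ((F.mapHomologicalComplex _).map g ≫ counitComplex adj K), ?_⟩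
    dsimp only
    rw [Q_map_unitComplex_comp, Functor.map_comp _ _ (counitComplex adj K),
      ← reassoc_of% unitComplex_naturality adj, unitComplex_map_counitComplex, Category.comp_id, hg]
    simp

variable [EnoughProjectives C] {LF : DerivedCategory.Minus C ⥤ DerivedCategory.Minus D}
  {α : minusQ C ⋙ LF ⟶ mapMinusComplex F ⋙ minusQ D} (h : IsLeftDerivedMinus F LF α)

/-- The unit `P ⟶ R(LF(P))` on a bounded above complex `P` of projectives. -/
noncomputable def derivedUnitApp (P : MinusComplex C) (hP : projectiveComplex C P) :
    DerivedCategory.Q.obj P.obj ⟶ R.mapDerivedCategory.obj (LF.obj ((minusQ C).obj P)).obj :=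
  DerivedCategory.Q.map (unitComplex adj P.obj) ≫
    R.mapDerivedCategoryFactors.inv.app ((F.mapHomologicalComplex _).obj P.obj) ≫
    R.mapDerivedCategory.map (derivedIso h P hP).inv

theorem derivedUnitApp_naturality {P P' : MinusComplex C} (hP : projectiveComplex C P)
    (hP' : projectiveComplex C P') (f : P ⟶ P') :
    DerivedCategory.Q.map f.hom ≫ derivedUnitApp adj h P' hP' =
      derivedUnitApp adj h P hP ≫ R.mapDerivedCategory.map (LF.map ((minusQ C).map f)).hom := by
  have h₁ := R.mapDerivedCategoryFactors.inv.naturality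
    ((F.mapHomologicalComplex (ComplexShape.up ℤ)).map f.hom)
  dsimp only [Functor.comp_map] at h₁
  rw [derivedUnitApp, derivedUnitApp, Category.assoc, Category.assoc, ← Functor.map_comp,
    ← derivedIso_inv_naturality h hP hP' f, Functor.map_comp, ← reassoc_of% h₁,
    ← Functor.map_comp_assoc, ← Functor.map_comp_assoc, unitComplex_naturality]

theorem derivedUnitApp_bijective (P : MinusComplex C) (hP : projectiveComplex C P)
    (K : CochainComplex D ℤ) :
    Function.Bijective (fun f : (LF.obj ((minusQ C).obj P)).obj ⟶ DerivedCategory.Q.obj K =>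
      derivedUnitApp adj h P hP ≫ R.mapDerivedCategory.map f) := by
  rw [← Function.Bijective.of_comp_iff _ ((derivedIso h P hP).homFromEquiv.symm.bijective)]
  convert Q_map_unitComplex_bijective adj P hP K using 2 with f
  simp [derivedUnitApp, ← Functor.map_comp]

/-- The derived unit `Y ⟶ R(LF(Y))`. -/
noncomputable def derivedUnit :
    DerivedCategory.Minus.ι ⟶ LF ⋙ DerivedCategory.Minus.ι ⋙ R.mapDerivedCategory :=
  ((projectiveComplex C).ι ⋙ minusQ C).extendNatTrans
    { app := fun P => derivedUnitApp adj h P.obj P.property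
      naturality := fun P P' f => derivedUnitApp_naturality adj h P.property P'.property f.hom }

theorem derivedUnit_app (P : MinusComplex C) (hP : projectiveComplex C P) :
    (derivedUnit adj h).app ((minusQ C).obj P) = derivedUnitApp adj h P hP :=
  Functor.extendNatTrans_app ((projectiveComplex C).ι ⋙ minusQ C) _ ⟨P, hP⟩

/-- The claim is invariant under isomorphism in `Y` and `X`, so `Y` may be a projective complex and
`X` the image of a complex. -/
theorem derivedUnit_bijective (Y : DerivedCategory.Minus C) (X : DerivedCategory D) :
    Function.Bijective (fun f : (LF.obj Y).obj ⟶ X =>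
      (derivedUnit adj h).app Y ≫ R.mapDerivedCategory.map f) := by
  obtain ⟨P, hP, ⟨e⟩⟩ := exists_projectiveComplex_iso' Y
  refine NatTrans.bijective_app_comp_map_of_iso (L := LF ⋙ DerivedCategory.Minus.ι)
    (derivedUnit adj h) e
    (DerivedCategory.Q.objObjPreimageIso X) ?_
  rw [derivedUnit_app adj h P hP]
  exact derivedUnitApp_bijective adj h P hP _

theorem isIso_derivedUnit_app [IsIso adj.unit] (Y : DerivedCategory.Minus C) :
    IsIso ((derivedUnit adj h).app Y) := by
  obtain ⟨P, hP, ⟨e⟩⟩ := exists_projectiveComplex_iso' Y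
  rw [← NatTrans.isIso_app_iff_of_iso _ e, derivedUnit_app adj h P hP]
  exact inferInstanceAs (IsIso (DerivedCategory.Q.map (unitComplex adj P.obj) ≫
    R.mapDerivedCategoryFactors.inv.app ((F.mapHomologicalComplex _).obj P.obj) ≫
    R.mapDerivedCategory.map (derivedIso h P hP).inv))

end Adjunction

end ExtendedModule

/-! ### Truncations in a t-structure. -/

namespace CategoryTheory.Triangulated.TStructure

open Pretriangulated

variable {C : Type*} [Category* C] [Preadditive C] [HasZeroObject C] [HasShift C ℤ]
  [∀ n : ℤ, (shiftFunctor C n).Additive] [Pretriangulated C] (t : TStructure C)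

theorem isLE_truncGE_obj (X : C) (a n : ℤ) [t.IsLE X n] : t.IsLE ((t.truncGE a).obj X) n := by
  -- If `a ≤ n + 1`, a map to an object `≥ n + 1` is determined by its restriction along `X ⟶ σ^{≥
  -- a} X`, which vanishes as `X` is `≤ n`. Otherwise `X` is `≤ a - 1` and its truncation is zero.
  by_cases hn : a ≤ n + 1
  · rw [t.isLE_iff_orthogonal n (n + 1) rfl]
    intro Y f hY
    have := t.isGE_of_ge Y a (n + 1) hn
    exact t.from_truncGE_obj_ext (by
      rw [comp_zero]
      exact t.zero (X := X) _ n (n + 1) (by lia))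
  · have := t.isLE_of_le X n (a - 1) (by lia)
    exact t.isLE_of_isZero (t.isZero_truncGE_obj_of_isLE (a - 1) a (by lia) X) n

theorem bijective_truncGEπ_comp (X Y : C) (n : ℤ) [t.IsGE Y n] :
    Function.Bijective (fun f : (t.truncGE n).obj X ⟶ Y => (t.truncGEπ n).app X ≫ f) :=
  ⟨fun _ _ h => t.from_truncGE_obj_ext h, fun f => ⟨t.descTruncGE f n, t.π_descTruncGE f n⟩⟩

theorem isZero_of_isLE_of_isGE (X : C) (a b : ℤ) (h : a < b) [t.IsLE X a] [t.IsGE X b] :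
    IsZero X := by
  rw [IsZero.iff_id_eq_zero]
  exact t.zero _ a b h

end CategoryTheory.Triangulated.TStructure

/-! ### The truncated adjunction on extended categories. -/

namespace ExtendedModule

variable {C : Type u} [Category.{v} C] [Abelian C] [HasDerivedCategory.{w} C]
  {D : Type u'} [Category.{v} D] [Abelian D] [HasDerivedCategory.{w'} D]

open DerivedCategory.TStructure Pretriangulated

section

variable (R : D ⥤ C) [R.Additive] [PreservesFiniteLimits R] [PreservesFiniteColimits R]

theorem isLE_mapDerivedCategory_obj (X : DerivedCategory D) (n : ℤ) (hX : X.IsLE n) :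
    (R.mapDerivedCategory.obj X).IsLE n := by
  obtain ⟨K, e, hK⟩ := hX
  exact ⟨(R.mapHomologicalComplex _).obj K, R.mapDerivedCategory.mapIso e ≪≫
    R.mapDerivedCategoryFactors.app K, inferInstance⟩

theorem isGE_mapDerivedCategory_obj (X : DerivedCategory D) (n : ℤ) (hX : X.IsGE n) :
    (R.mapDerivedCategory.obj X).IsGE n := by
  obtain ⟨K, e, hK⟩ := hX
  exact ⟨(R.mapHomologicalComplex _).obj K, R.mapDerivedCategory.mapIso e ≪≫
    R.mapDerivedCategoryFactors.app K, inferInstance⟩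

/-- An exact functor sends `X ⟶ σ^{≥ n} X` to an isomorphism if it sends `X` to an object which is
`≥ n`. -/
theorem isIso_mapDerivedCategory_map_truncGEπ (X : DerivedCategory D) (n : ℤ)
    (hX : (R.mapDerivedCategory.obj X).IsGE n) :
    IsIso (R.mapDerivedCategory.map ((t.truncGEπ n).app X)) := by
  have hT := R.mapDerivedCategory.map_distinguished _ (t.triangleLTGE_distinguished n X)
  refine (Triangle.isZero₁_iff_isIso₂ _ hT).1 ?_
  have h₁ : t.IsLE (R.mapDerivedCategory.obj ((t.truncLT n).obj X)) (n - 1) :=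
    isLE_mapDerivedCategory_obj R _ _ inferInstance
  have h₃ : t.IsGE (R.mapDerivedCategory.obj ((t.truncGE n).obj X)) n :=
    isGE_mapDerivedCategory_obj R _ _ inferInstance
  -- In the inverse rotated triangle, `R(σ^{<n} X)` lies between `R(σ^{≥n} X)⟦-1⟧` and `R(X)`, both
  -- `≥ n`. Being also `≤ n - 1`, it is zero.
  have h₃' : t.IsGE ((R.mapDerivedCategory.obj ((t.truncGE n).obj X))⟦(-1 : ℤ)⟧) n :=
    have := t.isGE_shift (R.mapDerivedCategory.obj ((t.truncGE n).obj X)) n (-1) (n + 1) (by lia)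
    t.isGE_of_ge _ n (n + 1) (by lia)
  have h₁' : t.IsGE (R.mapDerivedCategory.obj ((t.truncLT n).obj X)) n :=
    t.isGE₂ _ (inv_rot_of_distTriang _ hT) n h₃' hX
  exact t.isZero_of_isLE_of_isGE (R.mapDerivedCategory.obj ((t.truncLT n).obj X)) (n - 1) n
    (by lia)

end

variable {F : C ⥤ D} [F.Additive] [EnoughProjectives C]
  {LF : DerivedCategory.Minus C ⥤ DerivedCategory.Minus D}
  {α : minusQ C ⋙ LF ⟶ mapMinusComplex F ⋙ minusQ D} (h : IsLeftDerivedMinus F LF α)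

include h in
theorem isLE_leftDerived_obj (Y : DerivedCategory.Minus C) (n : ℤ) (hY : Y.obj.IsLE n) :
    (LF.obj Y).obj.IsLE n := by
  obtain ⟨P, hP, hPn, ⟨e⟩⟩ := exists_projectiveComplex_iso Y n hY
  exact ⟨(F.mapHomologicalComplex _).obj P.obj,
    DerivedCategory.Minus.ι.mapIso (LF.mapIso e.symm) ≪≫ derivedIso h P hP, inferInstance⟩

include h in
theorem extProp_truncDerived_obj (m : ℕ) (Y : Ext C m) :
    extProp D m ((truncDerived LF m).obj Y) := by
  rw [extProp_iff]
  have : t.IsLE (DerivedCategory.Minus.ι.obj (LF.obj ((toMinus m).obj Y))) 0 :=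
    isLE_leftDerived_obj h _ 0 ((extProp_iff m Y.obj).1 Y.property).1
  exact ⟨t.isLE_truncGE_obj _ _ _, t.isGE_truncGE_obj _ _ _⟩

variable {R : D ⥤ C} [R.Additive] [PreservesFiniteLimits R] [PreservesFiniteColimits R]
  (adj : F ⊣ R) (m : ℕ)

/-- The morphism `Y ⟶ R(σ^{≥ -(m-1)} LF(Y))` in the derived category. -/
noncomputable def truncDerivedUnitApp (Y : Ext C m) :
    Y.obj ⟶ R.mapDerivedCategory.obj ((truncDerived LF m).obj Y) :=
  (derivedUnit adj h).app ((toMinus m).obj Y) ≫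
    R.mapDerivedCategory.map ((t.truncGEπ (-((m : ℤ) - 1))).app (LF.obj ((toMinus m).obj Y)).obj)

theorem truncDerivedUnitApp_naturality {Y Y' : Ext C m} (f : Y ⟶ Y') :
    f.hom ≫ truncDerivedUnitApp h adj m Y' =
      truncDerivedUnitApp h adj m Y ≫ R.mapDerivedCategory.map ((truncDerived LF m).map f) := by
  have h₁ : f.hom ≫ (derivedUnit adj h).app ((toMinus m).obj Y') =
      (derivedUnit adj h).app ((toMinus m).obj Y) ≫
        R.mapDerivedCategory.map (LF.map ((toMinus m).map f)).hom :=
    (derivedUnit adj h).naturality ((toMinus m).map f)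
  have h₂ := (t.truncGEπ (-((m : ℤ) - 1))).naturality (LF.map ((toMinus m).map f)).hom
  rw [truncDerivedUnitApp, truncDerivedUnitApp, reassoc_of% h₁, Category.assoc]
  exact congrArg _ ((R.mapDerivedCategory.map_comp _ _).symm.trans
    ((congrArg R.mapDerivedCategory.map h₂).trans (R.mapDerivedCategory.map_comp _ _)))

/-- Composite of two universal properties: that of `LF Y ⟶ σ^{≥ -(m-1)} LF Y` for targets `≥
-(m-1)`, and that of the derived unit. -/
theorem truncDerivedUnitApp_bijective (Y : Ext C m) (X : DerivedCategory D)
    (hX : X.IsGE (-((m : ℤ) - 1))) :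
    Function.Bijective (fun f : (truncDerived LF m).obj Y ⟶ X =>
      truncDerivedUnitApp h adj m Y ≫ R.mapDerivedCategory.map f) := by
  refine (iff_of_eq (congrArg Function.Bijective (funext fun f => ?_))).mp
    ((derivedUnit_bijective adj h ((toMinus m).obj Y) X).comp
      (t.bijective_truncGEπ_comp (LF.obj ((toMinus m).obj Y)).obj X (-((m : ℤ) - 1))))
  rw [truncDerivedUnitApp, Category.assoc]
  exact congrArg _ (R.mapDerivedCategory.map_comp _ _)

/-- The derived unit identifies `R(LF Y)` with `Y`, which is `≥ -(m-1)`; hence `R` also inverts the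
truncation map. -/
theorem isIso_truncDerivedUnitApp [IsIso adj.unit] (Y : Ext C m) :
    IsIso (truncDerivedUnitApp h adj m Y) := by
  have := isIso_derivedUnit_app adj h ((toMinus m).obj Y)
  have hY : t.IsGE (R.mapDerivedCategory.obj (LF.obj ((toMinus m).obj Y)).obj)
      (-((m : ℤ) - 1)) :=
    have : t.IsGE Y.obj (-((m : ℤ) - 1)) := ((extProp_iff m Y.obj).1 Y.property).2
    t.isGE_of_iso (asIso ((derivedUnit adj h).app ((toMinus m).obj Y)) : Y.obj ≅ _) _
  have := isIso_mapDerivedCategory_map_truncGEπ R _ _ hY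
  exact IsIso.comp_isIso' inferInstance this

/-- The unit of the adjunction between `σ^{≥ -(m-1)} ∘ LF` and `R` on `m`-extended categories. -/
noncomputable def truncDerivedUnit (h' : ∀ Y, extProp D m ((truncDerived LF m).obj Y)) :
    𝟭 (Ext C m) ⟶ (extProp D m).lift (truncDerived LF m) h' ⋙ mapExt R m where
  app Y := ObjectProperty.homMk (truncDerivedUnitApp h adj m Y)
  naturality _ _ f := ObjectProperty.hom_ext _ (truncDerivedUnitApp_naturality h adj m f)

theorem truncDerivedUnit_bijective (h' : ∀ Y, extProp D m ((truncDerived LF m).obj Y))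
    (Y : Ext C m) (X : Ext D m) :
    Function.Bijective (fun f : ((extProp D m).lift (truncDerived LF m) h').obj Y ⟶ X =>
      (truncDerivedUnit h adj m h').app Y ≫ (mapExt R m).map f) := by
  have hX := ((extProp_iff m X.obj).1 X.property).2
  constructor
  · intro f g hfg
    exact ObjectProperty.hom_ext _ ((truncDerivedUnitApp_bijective h adj m Y X.obj hX).injective
      (congrArg (fun φ => φ.hom) hfg))
  · intro k
    obtain ⟨f, hf⟩ := (truncDerivedUnitApp_bijective h adj m Y X.obj hX).surjective k.hom
    exact ⟨ObjectProperty.homMk f, ObjectProperty.hom_ext _ hf⟩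

/-- The functor `σ^{≥ -(m-1)} ∘ LF` on `m`-extended categories is left adjoint to the functor
induced by `R`. -/
noncomputable def truncDerivedAdjunction (h' : ∀ Y, extProp D m ((truncDerived LF m).obj Y)) :
    (extProp D m).lift (truncDerived LF m) h' ⊣ mapExt R m :=
  Adjunction.ofUnitBijective (truncDerivedUnit h adj m h') (truncDerivedUnit_bijective h adj m h')

instance [IsIso adj.unit] (h' : ∀ Y, extProp D m ((truncDerived LF m).obj Y)) :
    IsIso (truncDerivedAdjunction h adj m h').unit := by
  rw [truncDerivedAdjunction, Adjunction.ofUnitBijective_unit, NatTrans.isIso_iff_isIso_app]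
  intro Y
  have : IsIso ((extProp C m).ι.map ((truncDerivedUnit h adj m h').app Y)) :=
    isIso_truncDerivedUnitApp h adj m Y
  exact isIso_of_reflects_iso _ (extProp C m).ι

end ExtendedModule

/-! ### Enough projectives among finitely generated modules. -/

namespace FGModuleCat

variable {R : Type u} [Ring R] [IsNoetherianRing R]

theorem surjective_of_epi {M N : FGModuleCat.{u} R} (f : M ⟶ N) [Epi f] :
    Function.Surjective f.hom.hom :=
  (ModuleCat.epi_iff_surjective ((forget₂ (FGModuleCat.{u} R) (ModuleCat.{u} R)).map f)).1
    inferInstance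

instance projective_of_module_projective (P : Type u) [AddCommGroup P] [Module R P]
    [Module.Finite R P] [Module.Projective R P] : Projective (of R P) where
  factors {E X} f e he := by
    obtain ⟨g, hg⟩ := Module.projective_lifting_property e.hom.hom f.hom.hom (surjective_of_epi e)
    exact ⟨ofHom g, hom_ext hg⟩

instance : EnoughProjectives (FGModuleCat.{u} R) where
  presentation M := by
    obtain ⟨n, f, hf⟩ := Module.Finite.exists_fin' R M
    exact ⟨{  p := of R (Fin n → R)
              f := ofHom (V := Fin n → R) (W := M) f
              epi := ConcreteCategory.epi_of_surjective _ hf }⟩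

end FGModuleCat

/-! ### The adjunction between `Λe ⊗_Γ -` and `M ↦ eM`, and its invertible unit. -/

namespace IsIdempotentElem

variable {Λ : Type u} [Ring Λ] {e : Λ} (he : IsIdempotentElem e)

section

variable {N : Type u} [AddCommGroup N] [Module he.Corner N] {M : Type u} [AddCommGroup M]
  [Module Λ M]

theorem indMk_add (x : he.leftIdeal) (y y' : N) :
    he.indMk x (y + y') = he.indMk x y + he.indMk x y' := by
  simp [indMk, TensorProduct.tmul_add]

/-- The map `N ⟶ e(Λe ⊗_Γ N)`, `y ↦ e ⊗ y`. -/
def indUnit : N →ₗ[he.Corner] he.part (he.Ind N) where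
  toFun y := ⟨he.indMk he.idemElt y, by
    rw [mem_part]
    exact (he.indMk_eq_smul he.idemElt y).symm⟩
  map_add' y y' := Subtype.ext (he.indMk_add _ y y')
  map_smul' g y := Subtype.ext (by
    rw [RingHom.id_apply, coe_smul_part]
    change he.indMk he.idemElt (g • y) = g.val • he.indMk he.idemElt y
    rw [← indMk_rightMul, indMk_eq_smul]
    congr 1
    exact g.mul_val)

/-- The `Λ`-linear map `Λe ⊗_Γ N ⟶ M`, `x ⊗ y ↦ x f(y)`, associated with `f : N ⟶ eM`. -/
def indLift (f : N →ₗ[he.Corner] he.part M) : he.Ind N →ₗ[Λ] M :=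
  (he.balancedRel N).liftQ (TensorProduct.AlgebraTensorModule.lift
    { toFun := fun x =>
        { toFun := fun y => (x : Λ) • (f y : M)
          map_add' := fun y y' => by simp
          map_smul' := fun n y => by simpa using smul_comm (x : Λ) n (f y : M) }
      map_add' := fun x x' => by
        ext y
        simp [add_smul]
      map_smul' := fun r x => by
        ext y
        simp [mul_smul] }) (by
    rw [balancedRel, Submodule.span_le]
    rintro _ ⟨x, g, y, rfl⟩
    simp [rightMul, coe_smul_part, mul_smul])

@[simp]
theorem indLift_indMk (f : N →ₗ[he.Corner] he.part M) (x : he.leftIdeal) (y : N) :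
    he.indLift f (he.indMk x y) = (x : Λ) • (f y : M) := rfl

/-- `Γ`-linear maps `N ⟶ eM` are `Λ`-linear maps `Λe ⊗_Γ N ⟶ M`. -/
def indEquiv : (he.Ind N →ₗ[Λ] M) ≃ (N →ₗ[he.Corner] he.part M) where
  toFun f := (he.partMap f).comp he.indUnit
  invFun f := he.indLift f
  left_inv f := he.ind_hom_ext fun x y => by
    rw [indLift_indMk, indMk_eq_smul, map_smul]
    rfl
  right_inv f := by
    ext y
    change he.indLift f (he.indMk he.idemElt y) = f y
    rw [indLift_indMk]
    exact (f y).2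

/-- The map `x ⊗ y ↦ (e x) y` from `Λe ⊗_ℤ N` to `N`. -/
def tensorRetraction : he.leftIdeal ⊗[ℤ] N →ₗ[ℤ] N :=
  TensorProduct.lift
    { toFun := fun x =>
        { toFun := fun y => Corner.mk he (x : Λ) • y
          map_add' := smul_add _
          map_smul' := fun n y => smul_comm _ n y }
      map_add' := fun x x' => by
        ext y
        change Corner.mk he ((x : Λ) + x') • y = Corner.mk he (x : Λ) • y + Corner.mk he (x' : Λ) • y
        rw [← add_smul]
        congr 1
        apply Subtype.ext
        change e * ((x : Λ) + x') * e = e * x * e + e * x' * e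
        rw [mul_add, add_mul]
      map_smul' := fun n x => by
        ext y
        change Corner.mk he (n • (x : Λ)) • y = n • Corner.mk he (x : Λ) • y
        rw [← smul_assoc]
        congr 1
        apply Subtype.ext
        change e * (n • (x : Λ)) * e = n • (e * x * e)
        rw [mul_smul_comm, smul_mul_assoc] }

/-- `balancedRel` is a `Λ`-span while the retraction is only additive; quantifying over `r` lets the
span induction pass through scalars. -/
theorem tensorRetraction_smul_of_mem (t : he.leftIdeal ⊗[ℤ] N) (ht : t ∈ he.balancedRel N)
    (r : Λ) : he.tensorRetraction (r • t) = 0 := by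
  induction ht using Submodule.span_induction generalizing r with
  | mem t ht =>
    obtain ⟨x, g, y, rfl⟩ := ht
    rw [smul_sub, TensorProduct.smul_tmul', TensorProduct.smul_tmul', map_sub, sub_eq_zero]
    change Corner.mk he (r * ((x : Λ) * g.val)) • y = Corner.mk he (r * (x : Λ)) • g • y
    rw [← mul_smul]
    congr 1
    apply Subtype.ext
    change e * (r * ((x : Λ) * g.val)) * e = e * (r * (x : Λ)) * e * g.val
    simp only [mul_assoc, g.val_mul, g.mul_val]
  | zero => simp
  | add t t' _ _ h h' => rw [smul_add, map_add, h, h', add_zero]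
  | smul s t _ h => rw [smul_smul, h]

/-- The retraction vanishes on the relations and sends `e ⊗ y` to `(eee)y = y`. -/
theorem indUnit_injective : Function.Injective (he.indUnit (N := N)) := by
  rw [injective_iff_map_eq_zero]
  intro y hy
  have h : he.idemElt ⊗ₜ[ℤ] y ∈ he.balancedRel N :=
    (Submodule.Quotient.mk_eq_zero _).1 (congrArg Subtype.val hy)
  have h' := he.tensorRetraction_smul_of_mem _ h 1
  rw [one_smul] at h'
  change Corner.mk he e • y = 0 at h'
  rw [← h', eq_comm]
  have : Corner.mk he e = 1 := Subtype.ext (by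
    change e * e * e = e
    rw [he.eq, he.eq])
  rw [this, one_smul]

/-- For `x ∈ Λe` one has `e(x ⊗ y) = exe ⊗ y = e ⊗ (exe)y`, and every element of `e(Λe ⊗_Γ N)` is
fixed by `e`. -/
theorem indUnit_surjective : Function.Surjective (he.indUnit (N := N)) := by
  have key (z : he.Ind N) : ∃ y : N, he.indMk he.idemElt y = e • z := by
    obtain ⟨z, rfl⟩ := (he.balancedRel N).mkQ_surjective z
    induction z using TensorProduct.induction_on with
    | zero => exact ⟨0, by simp [indMk]⟩
    | tmul x y =>
      refine ⟨Corner.mk he (x : Λ) • y, ?_⟩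
      change _ = e • he.indMk x y
      rw [← indMk_rightMul, indMk_eq_smul, indMk_eq_smul he x, smul_smul]
      congr 1
      change e * (e * (x : Λ) * e) = e * x
      rw [mul_assoc e (x : Λ), show (x : Λ) * e = x from x.2, ← mul_assoc, he.eq]
    | add a b ha hb =>
      obtain ⟨y, hy⟩ := ha
      obtain ⟨y', hy'⟩ := hb
      exact ⟨y + y', by rw [indMk_add, hy, hy', map_add, smul_add]⟩
  intro z
  obtain ⟨y, hy⟩ := key z
  exact ⟨y, Subtype.ext (hy.trans z.2)⟩

end

variable [IsNoetherianRing Λ]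

/-- The functor `Λe ⊗_Γ -` is left adjoint to `M ↦ eM`. -/
def indAdjunction : he.ind ⊣ res.{u} he :=
  Adjunction.mkOfHomEquiv
    { homEquiv := fun _ _ =>
        { toFun := fun f => FGModuleCat.ofHom (he.indEquiv f.hom.hom)
          invFun := fun f => FGModuleCat.ofHom (he.indEquiv.symm f.hom.hom)
          left_inv := fun f => FGModuleCat.hom_ext (he.indEquiv.left_inv f.hom.hom)
          right_inv := fun f => FGModuleCat.hom_ext (he.indEquiv.right_inv f.hom.hom) }
      homEquiv_naturality_left_symm := fun _ _ =>
        FGModuleCat.hom_ext (he.ind_hom_ext fun _ _ => rfl)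
      homEquiv_naturality_right := fun _ _ => rfl }

instance : IsIso he.indAdjunction.unit := by
  rw [NatTrans.isIso_iff_isIso_app]
  intro N
  let E : N ≃ₗ[he.Corner] he.part (he.Ind N) :=
    LinearEquiv.ofBijective he.indUnit ⟨he.indUnit_injective, he.indUnit_surjective⟩
  refine ⟨FGModuleCat.ofHom E.symm.toLinearMap, FGModuleCat.hom_ext ?_, FGModuleCat.hom_ext ?_⟩
  · ext y
    exact E.symm_apply_apply y
  · ext y
    exact E.apply_symm_apply y

end IsIdempotentElem

theorem mainTheorem8 {K : Type*} [Field K] {Λ : Type u} [Ring Λ] [Algebra K Λ]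
    [FiniteDimensional K Λ] {e : Λ} (he : IsIdempotentElem e) (m : ℕ) (hm : 1 ≤ m) :
    haveI : IsNoetherianRing Λ := IsNoetherianRing.of_finite K Λ
    ∀ [HasDerivedCategory.{w} (FGModuleCat.{u} Λ)]
      [HasDerivedCategory.{w'} (FGModuleCat.{u} he.Corner)],
      Nonempty (he.ind ⊣ IsIdempotentElem.res.{u} he) ∧
      ExtendedModule.HasLeftDerivedMinus he.ind ∧
      ∀ (LL : DerivedCategory.Minus (FGModuleCat.{u} he.Corner) ⥤
            DerivedCategory.Minus (FGModuleCat.{u} Λ))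
        (α : ExtendedModule.minusQ _ ⋙ LL ⟶
            ExtendedModule.mapMinusComplex he.ind ⋙ ExtendedModule.minusQ _),
        ExtendedModule.IsLeftDerivedMinus he.ind LL α →
        (∀ P : ExtendedModule.MinusComplex (FGModuleCat.{u} he.Corner),
          (∀ i : ℤ, Projective (P.obj.X i)) → IsIso (α.app P)) ∧
        ∃ h : ∀ Y : ExtendedModule.Ext (FGModuleCat.{u} he.Corner) m,
            ExtendedModule.extProp (FGModuleCat.{u} Λ) m
              ((ExtendedModule.truncDerived LL m).obj Y),
          Nonempty ((ExtendedModule.extProp (FGModuleCat.{u} Λ) m).lift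
              (ExtendedModule.truncDerived LL m) h ⊣
            ExtendedModule.mapExt (IsIdempotentElem.res.{u} he) m) ∧
          ((ExtendedModule.extProp (FGModuleCat.{u} Λ) m).lift
            (ExtendedModule.truncDerived LL m) h).Full ∧
          ((ExtendedModule.extProp (FGModuleCat.{u} Λ) m).lift
            (ExtendedModule.truncDerived LL m) h).Faithful := by
  intro _ _
  have : IsNoetherianRing Λ := IsNoetherianRing.of_finite K Λ
  refine ⟨⟨he.indAdjunction⟩, ?_, fun LL α hα => ⟨fun P hP =>
    ExtendedModule.isIso_app_of_isLeftDerivedMinus hα hP,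
    ExtendedModule.extProp_truncDerived_obj hα m, ?_⟩⟩
  · obtain ⟨LF, α, h, -⟩ := ExtendedModule.exists_isLeftDerivedMinus he.ind
    exact Functor.HasRightKanExtension.mk LF α
  · let adj := ExtendedModule.truncDerivedAdjunction hα he.indAdjunction m
      (ExtendedModule.extProp_truncDerived_obj hα m)
    -- A left adjoint whose unit is an isomorphism is fully faithful.
    exact ⟨⟨adj⟩, adj.fullyFaithfulLOfIsIsoUnit.full, adj.fullyFaithfulLOfIsIsoUnit.faithful⟩
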